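/- Let $n \ge 0$ and $\Gamma = \mathbb{Z}^n$, with neutral element $0$. Let $L^1(\mathbb{Z}^n)$ be the algebra of absolutely summable functions $\mathbb{Z}^n \to \mathbb{C}$ under convolution; it contains the group ring $\mathbb{C}[\mathbb{Z}^n]$. Let $\mathcal{N}\mathbb{Z}^n$ be the group von Neumann algebra, i.e. the algebra of all bounded operators on the Hilbert space $L^2(\mathbb{Z}^n)$ of square summable functions that commute with all translations. An element $f = \sum_\nu a_\nu\, \nu \in \mathbb{C}[\mathbb{Z}^n]$ is regarded as an element of $\mathcal{N}\mathbb{Z}^n$ through the injective algebra homomorphism $r(f) = \sum_\nu a_\nu R_{-\nu}$, where $(R_\nu x)_{\nu'} = x_{\nu' - \nu}$. For $A \in \mathcal{N}\mathbb{Z}^n$ put $\mathrm{tr}_{\mathcal{N}\mathbb{Z}^n}(A) = (A\delta_0, \delta_0)$, where $\delta_0 \in L^2(\mathbb{Z}^n)$ is the indicator function of $\{0\}$. For a unit $u$ of $\mathcal{N}\mathbb{Z}^n$ the Fuglede--Kadison determinant is $\det_{\mathcal{N}\mathbb{Z}^n} u = \exp\left(\frac12 \mathrm{tr}_{\mathcal{N}\mathbb{Z}^n}(\log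 u u^*)\right)$, with $\log uu^*$ defined by functional calculus, and one writes $\det_{\mathcal{N}\mathbb{Z}^n} f$ for $\det_{\mathcal{N}\mathbb{Z}^n} r(f)$. Let $T^n = \{z \in \mathbb{C}^n : |z_1| = \dots = |z_n| = 1\}$ with normalized Haar measure $\mu$, and view $f$ as the Laurent polynomial $f(z) = \sum_\nu a_\nu z_1^{\nu_1} \cdots z_n^{\nu_n}$. For every $f \in \mathbb{C}[\mathbb{Z}^n]$ the following conditions are equivalent: (a) $f$ is a unit in $L^1(\mathbb{Z}^n)$; (b) $f$ is a unit in $\mathcal{N}\mathbb{Z}^n$; (c) $f(z) \neq 0$ for every $z \in T^n$. Under these conditions the function $\log|f|$ is $\mu$-integrable on $T^n$ and $$\det\nolimits_{\mathcal{N}\mathbb{Z}^n} f = \exp \int_{T^n} \log |f(z)| \, d\mu(z).$$ -/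

import Mathlib

open scoped ENNReal

noncomputable section

/-! ### The convolution algebra `L¹(Γ)` -/

/-- The underlying Banach space of the `L¹`-convolution algebra of a discrete (additively written)
group `Γ`: absolutely summable functions `Γ → ℂ` with the norm `∑ |a γ|`. -/
def ConvL1 (Γ : Type*) : Type _ := lp (fun _ : Γ => ℂ) 1

namespace ConvL1

variable {Γ : Type*}

instance : NormedAddCommGroup (ConvL1 Γ) :=
  inferInstanceAs (NormedAddCommGroup (lp (fun _ : Γ => ℂ) 1))

instance : NormedSpace ℂ (ConvL1 Γ) :=
  inferInstanceAs (NormedSpace ℂ (lp (fun _ : Γ => ℂ) 1))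

instance : CompleteSpace (ConvL1 Γ) :=
  inferInstanceAs (CompleteSpace (lp (fun _ : Γ => ℂ) 1))

instance : CoeFun (ConvL1 Γ) (fun _ => Γ → ℂ) := ⟨fun a => a.1⟩

theorem memℓp_one_iff {a : Γ → ℂ} :
    Memℓp (E := fun _ : Γ => ℂ) a 1 ↔ Summable fun γ => ‖a γ‖ := by
  rw [memℓp_gen_iff (by simp)]
  simp

theorem summable_norm (a : ConvL1 Γ) : Summable fun γ => ‖a γ‖ :=
  memℓp_one_iff.1 a.2

/-- An absolutely summable function as an element of `L¹(Γ)`. -/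
def mk (a : Γ → ℂ) (ha : Summable fun γ => ‖a γ‖) : ConvL1 Γ :=
  ⟨a, memℓp_one_iff.2 ha⟩

@[simp] theorem mk_apply (a : Γ → ℂ) (ha : Summable fun γ => ‖a γ‖) (γ : Γ) :
    mk a ha γ = a γ := rfl

theorem ext {a b : ConvL1 Γ} (h : ∀ γ, a γ = b γ) : a = b :=
  Subtype.ext (funext h)

theorem norm_eq (a : ConvL1 Γ) : ‖a‖ = ∑' γ, ‖a γ‖ := by
  have h := lp.norm_eq_tsum_rpow (E := fun _ : Γ => ℂ) (p := 1) (by simp) a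
  simp only [ENNReal.toReal_one, Real.rpow_one, div_one] at h
  exact h

theorem add_apply (a b : ConvL1 Γ) (γ : Γ) : (a + b) γ = a γ + b γ := rfl

variable [AddGroup Γ]

theorem summable_conv_prod (a b : ConvL1 Γ) :
    Summable fun p : Γ × Γ => ‖a p.1 * b (-p.1 + p.2)‖ := by
  have h := Summable.mul_norm a.summable_norm b.summable_norm
  let e : Γ × Γ ≃ Γ × Γ :=
    { toFun := fun p => (p.1, -p.1 + p.2)
      invFun := fun p => (p.1, p.1 + p.2)
      left_inv := fun p => by simp
      right_inv := fun p => by simp }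
  exact e.summable_iff.2 h

theorem summable_conv (a b : ConvL1 Γ) (γ : Γ) :
    Summable fun δ => ‖a δ * b (-δ + γ)‖ :=
  (a.summable_conv_prod b).comp_injective
    (i := fun δ : Γ => (δ, γ)) (fun _ _ h => (Prod.ext_iff.1 h).1)

theorem summable_conv_prod_swap (a b : ConvL1 Γ) :
    Summable fun p : Γ × Γ => ‖a p.2 * b (-p.2 + p.1)‖ :=
  (Equiv.prodComm Γ Γ).summable_iff.2 (a.summable_conv_prod b)

theorem norm_conv_le (a b : ConvL1 Γ) (γ : Γ) :
    ‖∑' δ, a δ * b (-δ + γ)‖ ≤ ∑' δ, ‖a δ * b (-δ + γ)‖ :=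
  norm_tsum_le_tsum_norm (a.summable_conv b γ)

theorem summable_norm_conv (a b : ConvL1 Γ) :
    Summable fun γ => ‖∑' δ, a δ * b (-δ + γ)‖ :=
  Summable.of_nonneg_of_le (fun _ => norm_nonneg _) (a.norm_conv_le b)
    (a.summable_conv_prod_swap b).prod

/-- The convolution product `(a * b)(γ) = ∑_δ a(δ) b(δ⁻¹γ)`, in additive notation. -/
instance : Mul (ConvL1 Γ) :=
  ⟨fun a b => mk (fun γ => ∑' δ, a δ * b (-δ + γ)) (a.summable_norm_conv b)⟩

theorem mul_apply (a b : ConvL1 Γ) (γ : Γ) : (a * b) γ = ∑' δ, a δ * b (-δ + γ) := rfl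

open Classical in
/-- The unit of the convolution algebra is the indicator function of the neutral element. -/
instance : One (ConvL1 Γ) :=
  ⟨mk (fun γ => if γ = 0 then 1 else 0)
    (summable_of_ne_finset_zero (s := {0}) (fun γ hγ => by
      have : γ ≠ 0 := by simpa using hγ
      simp [this]))⟩

open Classical in
theorem one_apply (γ : Γ) : (1 : ConvL1 Γ) γ = if γ = 0 then 1 else 0 := rfl

theorem mul_assoc' (a b c : ConvL1 Γ) : a * b * c = a * (b * c) := by
  refine ext fun γ => ?_
  simp only [mul_apply]
  have hS : Summable fun p : Γ × Γ => a p.2 * b (-p.2 + p.1) * c (-p.1 + γ) := by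
    refine Summable.of_norm (Summable.of_nonneg_of_le (fun _ => norm_nonneg _) (fun p => ?_)
      ((a.summable_conv_prod_swap b).mul_right ‖c‖))
    rw [norm_mul (a p.2 * b (-p.2 + p.1))]
    refine mul_le_mul_of_nonneg_left ?_ (norm_nonneg _)
    rw [norm_eq]
    exact c.summable_norm.le_tsum _ (fun _ _ => norm_nonneg _)
  calc ∑' ε, (∑' δ, a δ * b (-δ + ε)) * c (-ε + γ)
      = ∑' ε, ∑' δ, a δ * b (-δ + ε) * c (-ε + γ) := by
        refine tsum_congr fun ε => ?_
        rw [tsum_mul_right]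
    _ = ∑' δ, ∑' ε, a δ * b (-δ + ε) * c (-ε + γ) :=
        Summable.tsum_comm (f := fun ε δ => a δ * b (-δ + ε) * c (-ε + γ)) hS |>.symm
    _ = ∑' δ, a δ * ∑' ε, b ε * c (-ε + (-δ + γ)) := by
        refine tsum_congr fun δ => ?_
        rw [← tsum_mul_left, ← (Equiv.addLeft δ).tsum_eq]
        refine tsum_congr fun ε => ?_
        have h : -(δ + ε) + γ = -ε + (-δ + γ) := by rw [neg_add_rev, add_assoc]
        rw [Equiv.coe_addLeft, neg_add_cancel_left, h, mul_assoc]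

theorem one_mul' (a : ConvL1 Γ) : 1 * a = a := by
  refine ext fun γ => ?_
  rw [mul_apply, tsum_eq_single 0]
  · rw [one_apply, if_pos rfl, one_mul]
    exact congrArg a.1 (by simp)
  · intro δ hδ
    simp [one_apply, hδ]

theorem mul_one' (a : ConvL1 Γ) : a * 1 = a := by
  refine ext fun γ => ?_
  rw [mul_apply, tsum_eq_single γ]
  · simp [one_apply]
  · intro δ hδ
    have : -δ + γ ≠ 0 := fun h => hδ (by rw [neg_add_eq_zero] at h; exact h)
    simp [one_apply, this]

theorem mul_add' (a b c : ConvL1 Γ) : a * (b + c) = a * b + a * c := by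
  refine ext fun γ => ?_
  rw [add_apply]
  simp only [mul_apply, add_apply, mul_add]
  exact (a.summable_conv b γ).of_norm.tsum_add (a.summable_conv c γ).of_norm

theorem add_mul' (a b c : ConvL1 Γ) : (a + b) * c = a * c + b * c := by
  refine ext fun γ => ?_
  rw [add_apply]
  simp only [mul_apply, add_apply, add_mul]
  exact (a.summable_conv c γ).of_norm.tsum_add (b.summable_conv c γ).of_norm

theorem zero_mul' (a : ConvL1 Γ) : 0 * a = 0 := by
  have h := add_mul' 0 0 a
  rw [add_zero] at h
  exact left_eq_add.1 h

theorem mul_zero' (a : ConvL1 Γ) : a * 0 = 0 := by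
  have h := mul_add' a 0 0
  rw [add_zero] at h
  exact left_eq_add.1 h

theorem norm_mul_le' (a b : ConvL1 Γ) : ‖a * b‖ ≤ ‖a‖ * ‖b‖ := by
  have hs := a.summable_conv_prod_swap b
  calc ‖a * b‖ = ∑' γ, ‖∑' δ, a δ * b (-δ + γ)‖ := norm_eq _
    _ ≤ ∑' γ, ∑' δ, ‖a δ * b (-δ + γ)‖ :=
        (a.summable_norm_conv b).tsum_le_tsum (a.norm_conv_le b) hs.prod
    _ = ∑' δ, ∑' γ, ‖a δ * b (-δ + γ)‖ :=
        (Summable.tsum_comm (f := fun γ δ => ‖a δ * b (-δ + γ)‖) hs).symm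
    _ = ∑' δ, ‖a δ‖ * ‖b‖ := by
        refine tsum_congr fun δ => ?_
        simp only [norm_mul]
        rw [tsum_mul_left, norm_eq b, ← (Equiv.addLeft (-δ)).tsum_eq (fun γ => ‖b γ‖)]
        rfl
    _ = ‖a‖ * ‖b‖ := by rw [tsum_mul_right, norm_eq a]

/-- `L¹(Γ)` as a Banach algebra under convolution. -/
instance : NormedRing (ConvL1 Γ) :=
  { (inferInstance : NormedAddCommGroup (ConvL1 Γ)) with
    mul := (· * ·)
    one := 1
    left_distrib := mul_add'
    right_distrib := add_mul'
    zero_mul := zero_mul'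
    mul_zero := mul_zero'
    mul_assoc := mul_assoc'
    one_mul := one_mul'
    mul_one := mul_one'
    norm_mul_le := norm_mul_le' }

/-- The inclusion `ℂΓ ⊆ L¹(Γ)`. -/
def ofGroupRing (f : AddMonoidAlgebra ℂ Γ) : ConvL1 Γ :=
  mk (fun γ => f.coeff γ) (summable_of_ne_finset_zero (s := f.coeff.support) (fun γ hγ => by
    simpa using hγ))

end ConvL1

/-! ### The group von Neumann algebra -/

/-- The Hilbert space `L²(Γ)` of square summable functions `Γ → ℂ`. -/
def GroupL2 (Γ : Type*) : Type _ := lp (fun _ : Γ => ℂ) 2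

namespace GroupL2

variable {Γ : Type*}

instance : NormedAddCommGroup (GroupL2 Γ) :=
  inferInstanceAs (NormedAddCommGroup (lp (fun _ : Γ => ℂ) 2))

instance : InnerProductSpace ℂ (GroupL2 Γ) :=
  inferInstanceAs (InnerProductSpace ℂ (lp (fun _ : Γ => ℂ) 2))

instance : CompleteSpace (GroupL2 Γ) :=
  inferInstanceAs (CompleteSpace (lp (fun _ : Γ => ℂ) 2))

instance : CoeFun (GroupL2 Γ) (fun _ => Γ → ℂ) := ⟨fun x => x.1⟩

theorem ext {x y : GroupL2 Γ} (h : ∀ γ, x γ = y γ) : x = y :=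
  Subtype.ext (funext h)

theorem norm_eq (x : GroupL2 Γ) :
    ‖x‖ = (∑' γ, ‖x γ‖ ^ (2 : ℝ≥0∞).toReal) ^ (1 / (2 : ℝ≥0∞).toReal) :=
  lp.norm_eq_tsum_rpow (E := fun _ : Γ => ℂ) (p := 2) (by simp) x

theorem memℓp_comp (e : Γ ≃ Γ) (x : GroupL2 Γ) :
    Memℓp (E := fun _ : Γ => ℂ) (fun γ => x (e γ)) 2 := by
  have h := (memℓp_gen_iff (p := 2) (by simp)).1 x.2
  exact (memℓp_gen_iff (p := 2) (by simp)).2 (e.summable_iff.2 h)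

open Classical in
/-- An element `γ` of `Γ`, regarded as an element of `L²(Γ)`: the indicator function of `{γ}`. -/
def delta (γ : Γ) : GroupL2 Γ := (lp.single 2 γ (1 : ℂ) : lp (fun _ : Γ => ℂ) 2)

/-- Precomposition with a permutation of `Γ` as a unitary operator of `L²(Γ)`. -/
def reindex (e : Γ ≃ Γ) : GroupL2 Γ ≃ₗᵢ[ℂ] GroupL2 Γ where
  toFun x := ⟨fun γ => x (e γ), memℓp_comp e x⟩
  invFun x := ⟨fun γ => x (e.symm γ), memℓp_comp e.symm x⟩
  map_add' _ _ := rfl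
  map_smul' _ _ := rfl
  left_inv x := ext fun γ => congrArg x.1 (e.apply_symm_apply γ)
  right_inv x := ext fun γ => congrArg x.1 (e.symm_apply_apply γ)
  norm_map' x := by
    rw [norm_eq, norm_eq]
    congr 1
    exact e.tsum_eq (fun γ => ‖x γ‖ ^ (2 : ℝ≥0∞).toReal)

variable [AddGroup Γ]

/-- Left translation by `γ`: `(γ x)(γ') = x(γ⁻¹γ')`, in additive notation. -/
def leftTranslation (γ : Γ) : GroupL2 Γ →L[ℂ] GroupL2 Γ :=
  ((reindex (Equiv.addLeft (-γ)) : GroupL2 Γ ≃L[ℂ] GroupL2 Γ) : GroupL2 Γ →L[ℂ] GroupL2 Γ)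

/-- Right translation by `γ`: `(R_γ x)(γ') = x(γ'γ⁻¹)`, in additive notation. -/
def rightTranslation (γ : Γ) : GroupL2 Γ →L[ℂ] GroupL2 Γ :=
  ((reindex (Equiv.addRight (-γ)) : GroupL2 Γ ≃L[ℂ] GroupL2 Γ) : GroupL2 Γ →L[ℂ] GroupL2 Γ)

theorem leftTranslation_apply (γ γ' : Γ) (x : GroupL2 Γ) :
    (leftTranslation γ x) γ' = x (-γ + γ') := rfl

theorem rightTranslation_apply (γ γ' : Γ) (x : GroupL2 Γ) :
    rightTranslation γ x γ' = x (γ' + -γ) := rfl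

theorem star_leftTranslation (γ : Γ) :
    star (leftTranslation γ) = leftTranslation (-γ) := by
  have h : star (leftTranslation γ) =
      (((reindex (Equiv.addLeft (-γ))).symm : GroupL2 Γ ≃L[ℂ] GroupL2 Γ) :
        GroupL2 Γ →L[ℂ] GroupL2 Γ) :=
    LinearIsometryEquiv.star_eq_symm (reindex (Equiv.addLeft (-γ)))
  rw [h]
  refine ContinuousLinearMap.ext fun x => ext fun γ' => ?_
  change x ((Equiv.addLeft (-γ)).symm γ') = x (- -γ + γ')
  simp

end GroupL2

open GroupL2

/-- The group von Neumann algebra `𝒩Γ = ℬ(L²(Γ))^Γ`: the bounded operators of `L²(Γ)` that commute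
with all left translations. -/
def groupVonNeumannAlgebra (Γ : Type*) [AddGroup Γ] : VonNeumannAlgebra (GroupL2 Γ) where
  carrier := {A | ∀ γ : Γ, leftTranslation γ * A = A * leftTranslation γ}
  mul_mem' {A B} hA hB γ := by
    rw [← mul_assoc, hA γ, mul_assoc, hB γ, mul_assoc]
  one_mem' γ := by simp
  add_mem' {A B} hA hB γ := by
    rw [mul_add, add_mul, hA γ, hB γ]
  zero_mem' γ := by simp
  algebraMap_mem' c γ := (Algebra.commutes c (leftTranslation γ)).symm
  star_mem' {A} hA γ := by
    have h := congrArg star (hA (-γ))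
    rw [star_mul, star_mul, star_leftTranslation, neg_neg] at h
    exact h.symm
  centralizer_centralizer' := by
    have h : {A : GroupL2 Γ →L[ℂ] GroupL2 Γ |
        ∀ γ : Γ, leftTranslation γ * A = A * leftTranslation γ} =
        Set.centralizer (Set.range leftTranslation) := by
      ext A
      simp [Set.mem_centralizer_iff]
    change Set.centralizer (Set.centralizer {A : GroupL2 Γ →L[ℂ] GroupL2 Γ |
        ∀ γ : Γ, leftTranslation γ * A = A * leftTranslation γ}) =
      {A : GroupL2 Γ →L[ℂ] GroupL2 Γ |
        ∀ γ : Γ, leftTranslation γ * A = A * leftTranslation γ}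
    rw [h, Set.centralizer_centralizer_centralizer]

namespace groupVonNeumannAlgebra

variable {Γ : Type*} [AddGroup Γ]

theorem mem_iff {A : GroupL2 Γ →L[ℂ] GroupL2 Γ} :
    A ∈ groupVonNeumannAlgebra Γ ↔ ∀ γ : Γ, leftTranslation γ * A = A * leftTranslation γ :=
  Iff.rfl

theorem rightTranslation_mem (γ : Γ) : rightTranslation γ ∈ groupVonNeumannAlgebra Γ := by
  refine mem_iff.2 fun δ => ?_
  refine ContinuousLinearMap.ext fun x => ext fun γ' => ?_
  change x (-δ + γ' + -γ) = x (-δ + (γ' + -γ))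
  rw [add_assoc]

theorem smul_mem' (a : ℂ) {A : GroupL2 Γ →L[ℂ] GroupL2 Γ}
    (hA : A ∈ groupVonNeumannAlgebra Γ) : a • A ∈ groupVonNeumannAlgebra Γ := by
  refine mem_iff.2 fun γ => ?_
  rw [mul_smul_comm, smul_mul_assoc, mem_iff.1 hA γ]

/-- The representation `r : ℂΓ → 𝒩Γ`, `∑ a_γ γ ↦ ∑ a_γ R_{γ⁻¹}`, through which `ℂΓ` is regarded as
a subalgebra of `𝒩Γ`. -/
def ofGroupRing (f : AddMonoidAlgebra ℂ Γ) : groupVonNeumannAlgebra Γ :=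
  ⟨∑ γ ∈ f.coeff.support, f.coeff γ • rightTranslation (-γ),
    sum_mem fun γ _ => smul_mem' _ (rightTranslation_mem (-γ))⟩

/-- The von Neumann trace `tr(A) = (A e, e)`, where `e` is the neutral element of `Γ` regarded as
an element of `L²(Γ)`. The inner product `(x, y)` is linear in `x`, so it is `inner ℂ y x`. -/
def trace (A : groupVonNeumannAlgebra Γ) : ℂ :=
  inner ℂ (delta (0 : Γ)) ((A : GroupL2 Γ →L[ℂ] GroupL2 Γ) (delta 0))

theorem log_mul_star_mem (u : groupVonNeumannAlgebra Γ) :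
    CFC.log ((u : GroupL2 Γ →L[ℂ] GroupL2 Γ) * star (u : GroupL2 Γ →L[ℂ] GroupL2 Γ)) ∈
      groupVonNeumannAlgebra Γ := by
  refine mem_iff.2 fun γ => ?_
  have h := mem_iff.1 (mul_mem u.2 (star_mem u.2)) γ
  exact ((Commute.cfc_real (show Commute _ _ from h.symm) Real.log).eq).symm

/-- `log (u u*)`, formed by the continuous functional calculus in `ℬ(L²(Γ))`, as an element of
`𝒩Γ`. -/
def logMulStar (u : groupVonNeumannAlgebra Γ) : groupVonNeumannAlgebra Γ :=
  ⟨CFC.log ((u : GroupL2 Γ →L[ℂ] GroupL2 Γ) * star (u : GroupL2 Γ →L[ℂ] GroupL2 Γ)),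
    log_mul_star_mem u⟩

/-- The trace of `log (u u*)` is a real number. -/
theorem trace_logMulStar_im (u : groupVonNeumannAlgebra Γ) : (trace (logMulStar u)).im = 0 := by
  have h : IsSelfAdjoint (CFC.log ((u : GroupL2 Γ →L[ℂ] GroupL2 Γ) *
      star (u : GroupL2 Γ →L[ℂ] GroupL2 Γ))) := IsSelfAdjoint.log
  have hs := ContinuousLinearMap.isSelfAdjoint_iff_isSymmetric.1 h
  exact hs.im_inner_self_apply _

/-- The Fuglede--Kadison determinant `exp (½ tr (log u u*))` of a unit `u` of `𝒩Γ`. -/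
def det (u : (groupVonNeumannAlgebra Γ)ˣ) : ℝ :=
  Real.exp (1 / 2 * (trace (logMulStar (u : groupVonNeumannAlgebra Γ))).re)

end groupVonNeumannAlgebra

/-! ### The torus -/

instance : MeasurableSpace Circle := borel Circle

instance : BorelSpace Circle := ⟨rfl⟩

/-- The normalized Haar measure of the torus `Tⁿ = {z ∈ ℂⁿ | |z₁| = ⋯ = |zₙ| = 1}`. -/
def torusHaar (n : ℕ) : MeasureTheory.Measure (Fin n → Circle) :=
  MeasureTheory.Measure.haarMeasure ⊤

/-- The value at `z ∈ Tⁿ` of `f = ∑ a_ν ν ∈ ℂ[ℤⁿ]` viewed as the Laurent polynomial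
`∑ a_ν z₁^ν₁ ⋯ zₙ^νₙ`. -/
def laurentEval {n : ℕ} (f : AddMonoidAlgebra ℂ (Fin n → ℤ)) (z : Fin n → Circle) : ℂ :=
  ∑ ν ∈ f.coeff.support, f.coeff ν * ∏ i, (z i : ℂ) ^ ν i

end

/-!
On the torus `Tⁿ`, Fourier analysis turns the group ring of `ℤⁿ` into Laurent polynomials, and both
completions of the group ring are read off from them.

For `L¹(ℤⁿ)`: evaluation at a point `z ∈ Tⁿ` extends to a multiplicative functional on `L¹(ℤⁿ)`
(`ConvL1.tsum_mul_character`), so a unit has no zeros. Conversely, `L¹(ℤⁿ)` is a commutative Banach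
algebra, and a non-unit is annihilated by one of its characters; as a character is determined on
the group ring by unimodular values on the generators of `ℤⁿ`, it is evaluation at a point of `Tⁿ`
there (`ConvL1.exists_laurentEval_eq_characterSpace`), so a non-unit in the group ring has a zero.

For the von Neumann algebra: the functions `z^(-ν)` form a Hilbert basis of `L²(Tⁿ)`, and in this
basis multiplication by the Laurent polynomial `f` is `r(f)` (`torusRep_laurentMap`). The
representation `torusRep` of `C(Tⁿ)` by multiplication operators is injective, so by spectral
permanence `r(f)` is invertible if and only if `f` is invertible in `C(Tⁿ)`
(`isUnit_ofGroupRing_iff`). In that case the representation sends `2 log |f|` to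
`log (r(f) r(f)*)` (`StarAlgHom.log_mul_star_map`), and the von Neumann trace becomes integration
over `Tⁿ` (`inner_delta_torusRep`), which gives the formula for the determinant.
-/

noncomputable section

open MeasureTheory GroupL2

/-! ### Fourier analysis on the torus -/

namespace torusHaar

variable {n : ℕ}

instance : (torusHaar n).IsHaarMeasure :=
  inferInstanceAs (Measure.haarMeasure ⊤).IsHaarMeasure

instance : (torusHaar n).Regular :=
  inferInstanceAs (Measure.haarMeasure ⊤).Regular

instance : IsProbabilityMeasure (torusHaar n) :=
  ⟨Measure.haarMeasure_self⟩

end torusHaar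

/-- The character `z ↦ z₁^ν₁ ⋯ zₙ^νₙ` of the torus, as a continuous function. -/
def torusChar {n : ℕ} (ν : Fin n → ℤ) : C(Fin n → Circle, ℂ) where
  toFun z := ((∏ i, z i ^ ν i : Circle) : ℂ)
  continuous_toFun := by fun_prop

namespace torusChar

variable {n : ℕ}

theorem apply_mul (ν : Fin n → ℤ) (z w : Fin n → Circle) :
    torusChar ν (z * w) = torusChar ν z * torusChar ν w := by
  simp [torusChar, mul_zpow, Finset.prod_mul_distrib]

theorem zero : torusChar (0 : Fin n → ℤ) = 1 := by
  ext z; simp [torusChar]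

theorem add (ν ν' : Fin n → ℤ) : torusChar (ν + ν') = torusChar ν * torusChar ν' := by
  ext z; simp [torusChar, zpow_add, Finset.prod_mul_distrib]

theorem neg (ν : Fin n → ℤ) : torusChar (-ν) = star (torusChar ν) := by
  ext z
  simp only [torusChar, ContinuousMap.coe_mk, ContinuousMap.star_apply, Pi.neg_apply, zpow_neg,
    Finset.prod_inv_distrib, Circle.coe_inv_eq_conj]
  rfl

theorem single (i : Fin n) (z : Fin n → Circle) : torusChar (Pi.single i 1) z = z i := by
  simp only [torusChar, ContinuousMap.coe_mk]
  rw [Finset.prod_eq_single i (fun j _ hj => by simp [hj]) (by simp)]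
  simp

/-- A nontrivial character takes a value other than `1`. -/
theorem exists_apply_ne_one {ν : Fin n → ℤ} (hν : ν ≠ 0) : ∃ w, torusChar ν w ≠ 1 := by
  obtain ⟨i, hi⟩ := Function.ne_iff.1 hν
  -- the `ν i`-th power of `exp (π i / ν i)` is `-1`
  refine ⟨Pi.mulSingle i (Circle.exp (Real.pi / ν i)), ?_⟩
  have hi' : (ν i : ℝ) ≠ 0 := by exact_mod_cast hi
  simp only [torusChar, ContinuousMap.coe_mk]
  rw [Finset.prod_eq_single i (fun j _ hj => by simp [hj]) (by simp), Pi.mulSingle_eq_same,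
    ← Circle.exp_intCast_mul, mul_div_cancel₀ _ hi']
  norm_num [Circle.coe_exp]

theorem integral_eq_zero {ν : Fin n → ℤ} (hν : ν ≠ 0) :
    ∫ z, torusChar ν z ∂(torusHaar n) = 0 := by
  obtain ⟨w, hw⟩ := exists_apply_ne_one hν
  have h := integral_mul_left_eq_self (μ := torusHaar n) (torusChar ν) w
  simp only [apply_mul] at h
  rw [integral_const_mul] at h
  by_contra h0
  exact hw (mul_right_cancel₀ h0 (h.trans (one_mul _).symm))

theorem orthonormal :
    Orthonormal ℂ fun ν : Fin n → ℤ =>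
      (ContinuousMap.toLp 2 (torusHaar n) ℂ (torusChar ν) : Lp ℂ 2 (torusHaar n)) := by
  rw [orthonormal_iff_ite]
  intro μ ν
  rw [ContinuousMap.inner_toLp]
  have h (z : Fin n → Circle) :
      torusChar ν z * (starRingEnd ℂ) (torusChar μ z) = torusChar (ν - μ) z := by
    rw [sub_eq_add_neg, add, neg]; rfl
  simp only [h]
  split_ifs with hμν
  · simp [hμν, zero]
  · exact integral_eq_zero (sub_ne_zero.2 (Ne.symm hμν))

/-- By the Stone–Weierstrass theorem. -/
theorem span_topologicalClosure :
    (Submodule.span ℂ (Set.range (torusChar (n := n)))).topologicalClosure = ⊤ := by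
  let S : StarSubalgebra ℂ C(Fin n → Circle, ℂ) :=
    { toSubalgebra := Algebra.adjoin ℂ (Set.range torusChar)
      star_mem' := by
        change Algebra.adjoin ℂ (Set.range torusChar) ≤
          star (Algebra.adjoin ℂ (Set.range torusChar))
        refine Algebra.adjoin_le ?_
        rintro _ ⟨ν, rfl⟩
        exact Algebra.subset_adjoin ⟨-ν, neg ν⟩ }
  have hsep : S.SeparatesPoints := by
    intro z w hzw
    obtain ⟨i, hi⟩ := Function.ne_iff.1 hzw
    refine ⟨_, ⟨torusChar (Pi.single i 1), Algebra.subset_adjoin ⟨_, rfl⟩, rfl⟩, ?_⟩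
    change torusChar (Pi.single i 1) z ≠ torusChar (Pi.single i 1) w
    rw [single, single]
    exact fun h => hi (Circle.coe_injective h)
  have hspan : Subalgebra.toSubmodule S.toSubalgebra =
      Submodule.span ℂ (Set.range (torusChar (n := n))) := by
    refine Algebra.adjoin_eq_span_of_subset _ ?_
    refine .trans (fun x => Submonoid.closure_induction (fun _ => id) ⟨0, zero⟩ ?_)
      Submodule.subset_span
    rintro _ _ _ _ ⟨μ, rfl⟩ ⟨ν, rfl⟩
    exact ⟨μ + ν, add μ ν⟩
  rw [← hspan]
  exact congrArg (Subalgebra.toSubmodule <| StarSubalgebra.toSubalgebra ·)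
    (ContinuousMap.starSubalgebra_topologicalClosure_eq_top_of_separatesPoints S hsep)

theorem span_toLp_topologicalClosure :
    (Submodule.span ℂ (Set.range fun ν : Fin n → ℤ =>
      (ContinuousMap.toLp 2 (torusHaar n) ℂ (torusChar ν) : Lp ℂ 2 (torusHaar n)))).topologicalClosure
      = ⊤ := by
  simpa only [Submodule.map_span, ContinuousLinearMap.coe_coe, ← Set.range_comp,
    Function.comp_def] using
    (ContinuousMap.toLp_denseRange ℂ (torusHaar n) ℂ
      (by simp : (2 : ℝ≥0∞) ≠ ∞)).topologicalClosure_map_submodule span_topologicalClosure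

/-- The Hilbert basis `ν ↦ z^(-ν)` of `L²(Tⁿ)`. The sign makes translation by `-γ` correspond to
multiplication by `z^γ`. -/
def hilbertBasis (n : ℕ) : HilbertBasis (Fin n → ℤ) ℂ (Lp ℂ 2 (torusHaar n)) :=
  HilbertBasis.mk (v := fun ν => ContinuousMap.toLp 2 (torusHaar n) ℂ (torusChar (-ν)))
    (orthonormal.comp _ neg_injective) (by
      rw [show (fun ν : Fin n → ℤ => (ContinuousMap.toLp 2 (torusHaar n) ℂ (torusChar (-ν)) :
          Lp ℂ 2 (torusHaar n))) = (fun ν => ContinuousMap.toLp 2 (torusHaar n) ℂ (torusChar ν)) ∘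
          Neg.neg from rfl, neg_surjective.range_comp, span_toLp_topologicalClosure])

theorem hilbertBasis_apply (ν : Fin n → ℤ) :
    hilbertBasis n ν = ContinuousMap.toLp 2 (torusHaar n) ℂ (torusChar (-ν)) := by
  rw [hilbertBasis, HilbertBasis.coe_mk]

end torusChar

/-! ### Multiplication operators -/

section Multiplication

variable {X : Type*} [TopologicalSpace X] [CompactSpace X] [MeasurableSpace X] [BorelSpace X]
  [SecondCountableTopologyEither X ℂ] (μ : Measure X) [IsFiniteMeasure μ]

/-- Multiplication by a continuous function as a bounded operator of `L²`. -/
def multiplicationCLM (g : C(X, ℂ)) : Lp ℂ 2 μ →L[ℂ] Lp ℂ 2 μ :=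
  (ContinuousLinearMap.mul ℂ ℂ).holderL μ ∞ 2 2 (ContinuousMap.toLp ∞ μ ℂ g)

theorem multiplicationCLM_coeFn (g : C(X, ℂ)) (x : Lp ℂ 2 μ) :
    multiplicationCLM μ g x =ᵐ[μ] fun t => g t * x t := by
  filter_upwards [(ContinuousLinearMap.mul ℂ ℂ).coeFn_holder (r := 2)
    (ContinuousMap.toLp ∞ μ ℂ g : Lp ℂ ∞ μ) x, ContinuousMap.coeFn_toLp (p := ∞) (𝕜 := ℂ) μ g]
    with t h1 h2
  change ((ContinuousLinearMap.mul ℂ ℂ).holder 2 (ContinuousMap.toLp ∞ μ ℂ g) x) t = _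
  rw [h1, h2]
  rfl

theorem multiplicationCLM_toLp (g h : C(X, ℂ)) :
    multiplicationCLM μ g (ContinuousMap.toLp 2 μ ℂ h) = ContinuousMap.toLp 2 μ ℂ (g * h) := by
  refine Lp.ext ?_
  filter_upwards [multiplicationCLM_coeFn μ g (ContinuousMap.toLp 2 μ ℂ h),
    ContinuousMap.coeFn_toLp (p := 2) (𝕜 := ℂ) μ h,
    ContinuousMap.coeFn_toLp (p := 2) (𝕜 := ℂ) μ (g * h)] with t h1 h2 h3
  rw [h1, h2, h3]
  rfl

theorem inner_multiplicationCLM (g : C(X, ℂ)) (x y : Lp ℂ 2 μ) :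
    inner ℂ (multiplicationCLM μ (star g) x) y = inner ℂ x (multiplicationCLM μ g y) := by
  rw [L2.inner_def, L2.inner_def]
  refine integral_congr_ae ?_
  filter_upwards [multiplicationCLM_coeFn μ (star g) x, multiplicationCLM_coeFn μ g y]
    with t h1 h2
  rw [h1, h2]
  simp only [RCLike.inner_apply, map_mul, ContinuousMap.star_apply, RCLike.star_def,
    starRingEnd_self_apply]
  ring

/-- The representation of `C(X)` on `L²(X)` by multiplication operators. -/
def multiplicationHom : C(X, ℂ) →⋆ₐ[ℂ] (Lp ℂ 2 μ →L[ℂ] Lp ℂ 2 μ) where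
  toFun := multiplicationCLM μ
  map_one' := by
    ext1 x
    refine Lp.ext ?_
    filter_upwards [multiplicationCLM_coeFn μ 1 x] with t h
    simp [h]
  map_mul' g h := by
    ext1 x
    refine Lp.ext ?_
    filter_upwards [multiplicationCLM_coeFn μ (g * h) x, multiplicationCLM_coeFn μ h x,
      multiplicationCLM_coeFn μ g (multiplicationCLM μ h x)] with t h1 h2 h3
    rw [h1, mul_apply_eq_comp, h3, h2, ContinuousMap.mul_apply, mul_assoc]
  map_zero' := by simp [multiplicationCLM]
  map_add' g h := by simp [multiplicationCLM]
  commutes' c := by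
    ext1 x
    refine Lp.ext ?_
    filter_upwards [multiplicationCLM_coeFn μ (algebraMap ℂ C(X, ℂ) c) x, Lp.coeFn_smul c x]
      with t h1 h2
    rw [h1, Algebra.algebraMap_eq_smul_one (A := Lp ℂ 2 μ →L[ℂ] Lp ℂ 2 μ),
      _root_.smul_apply, one_apply_eq_self, h2]
    rfl
  map_star' g := by
    rw [ContinuousLinearMap.star_eq_adjoint, ContinuousLinearMap.eq_adjoint_iff]
    exact inner_multiplicationCLM μ g

theorem multiplicationHom_toLp (g h : C(X, ℂ)) :
    multiplicationHom μ g (ContinuousMap.toLp 2 μ ℂ h) = ContinuousMap.toLp 2 μ ℂ (g * h) :=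
  multiplicationCLM_toLp μ g h

theorem multiplicationHom_injective [μ.IsOpenPosMeasure] :
    Function.Injective (multiplicationHom μ) := by
  intro g h hgh
  have h1 := congrArg (· (ContinuousMap.toLp 2 μ ℂ (1 : C(X, ℂ)))) hgh
  simp only [multiplicationHom_toLp, mul_one] at h1
  exact ContinuousMap.toLp_injective μ h1

end Multiplication

/-! ### Characters of `L¹(ℤⁿ)` -/

namespace ConvL1

variable {Γ : Type*}

/-- Over a commutative group, `L¹(Γ)` is a commutative Banach algebra. The instance is local, so
that elsewhere the ring structure of `L¹(Γ)` is inferred in only one way. -/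
local instance [AddCommGroup Γ] : NormedCommRing (ConvL1 Γ) :=
  { (inferInstance : NormedRing (ConvL1 Γ)) with
    mul_comm := fun a b => ext fun γ => by
      rw [mul_apply, mul_apply, ← (Equiv.subLeft γ).tsum_eq]
      refine tsum_congr fun δ => ?_
      have h : -(γ - δ) + γ = δ := by abel
      change a.1 (γ - δ) * b.1 (-(γ - δ) + γ) = b.1 δ * a.1 (-δ + γ)
      rw [h, mul_comm, neg_add_eq_sub] }

theorem smul_apply (c : ℂ) (a : ConvL1 Γ) (γ : Γ) : (c • a) γ = c * a γ := rfl

local instance [AddCommGroup Γ] : NormedAlgebra ℂ (ConvL1 Γ) :=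
  { Algebra.ofModule
      (fun c a b => ext fun γ => by
        simp only [mul_apply, smul_apply, mul_assoc, tsum_mul_left])
      (fun c a b => ext fun γ => by
        simp only [mul_apply, smul_apply, mul_left_comm _ c, tsum_mul_left]) with
    norm_smul_le := fun c a => norm_smul_le c a }

open Classical in
/-- An element `γ` of `Γ` as an element of `L¹(Γ)`: the indicator function of `{γ}`. -/
def delta (γ : Γ) : ConvL1 Γ :=
  mk (Pi.single γ 1) (summable_of_ne_finset_zero (s := {γ}) fun δ hδ => by
    have : δ ≠ γ := by simpa using hδ
    simp [this])

open Classical in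
theorem delta_apply (γ δ : Γ) : delta γ δ = if δ = γ then 1 else 0 := by
  simp [delta, Pi.single_apply]

theorem norm_delta (γ : Γ) : ‖delta γ‖ = 1 := by
  classical
  rw [norm_eq, tsum_eq_single γ (fun δ hδ => by simp [delta_apply, hδ])]
  simp [delta_apply]

theorem delta_zero [AddGroup Γ] : delta (0 : Γ) = 1 := by
  classical
  exact ext fun γ => by rw [delta_apply, one_apply]

theorem delta_mul [AddGroup Γ] (γ δ : Γ) : delta γ * delta δ = delta (γ + δ) := by
  classical
  refine ext fun ε => ?_
  rw [mul_apply, tsum_eq_single γ (fun ζ hζ => by simp [delta_apply, hζ])]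
  simp [delta_apply, neg_add_eq_iff_eq_add]

theorem ofGroupRing_eq_sum [AddCommGroup Γ] (f : AddMonoidAlgebra ℂ Γ) :
    ofGroupRing f = ∑ γ ∈ f.coeff.support, f.coeff γ • delta γ := by
  classical
  have hsum (s : Finset Γ) (a : Γ → ConvL1 Γ) (δ : Γ) : (∑ γ ∈ s, a γ) δ = ∑ γ ∈ s, a γ δ := by
    induction s using Finset.induction_on with
    | empty => rfl
    | insert γ s h ih => rw [Finset.sum_insert h, Finset.sum_insert h, add_apply, ih]
  refine ext fun δ => ?_
  rw [hsum]
  simp only [smul_apply, delta_apply, mul_ite, mul_one, mul_zero, Finset.sum_ite_eq]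
  by_cases h : f.coeff δ = 0 <;> simp [h, ofGroupRing]

/-- A character of `Γ` with values in the unit circle extends to a multiplicative functional on
`L¹(Γ)`. -/
theorem tsum_mul_character [AddGroup Γ] (χ : Multiplicative Γ →* Circle) (a b : ConvL1 Γ) :
    ∑' γ, (a * b) γ * χ (.ofAdd γ) =
      (∑' γ, a γ * χ (.ofAdd γ)) * ∑' γ, b γ * χ (.ofAdd γ) := by
  have hS : Summable fun p : Γ × Γ => a p.2 * b (-p.2 + p.1) * (χ (.ofAdd p.1) : ℂ) := by
    refine Summable.of_norm ((a.summable_conv_prod_swap b).congr fun p => ?_)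
    rw [norm_mul (a p.2 * b (-p.2 + p.1)), Circle.norm_coe, mul_one]
  calc ∑' γ, (a * b) γ * χ (.ofAdd γ)
      = ∑' γ, ∑' δ, a δ * b (-δ + γ) * χ (.ofAdd γ) := by
        refine tsum_congr fun γ => ?_
        rw [mul_apply, tsum_mul_right]
    _ = ∑' δ, ∑' γ, a δ * b (-δ + γ) * χ (.ofAdd γ) :=
        (Summable.tsum_comm
          (f := fun γ δ => a δ * b (-δ + γ) * (χ (.ofAdd γ) : ℂ)) hS).symm
    _ = ∑' δ, a δ * χ (.ofAdd δ) * ∑' γ, b γ * χ (.ofAdd γ) := by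
        refine tsum_congr fun δ => ?_
        rw [← tsum_mul_left, ← (Equiv.addLeft δ).tsum_eq]
        refine tsum_congr fun γ => ?_
        rw [Equiv.coe_addLeft, neg_add_cancel_left, ofAdd_add, map_mul, Circle.coe_mul]
        ring
    _ = _ := by rw [tsum_mul_right]

/-- The character `ν ↦ z₁^ν₁ ⋯ zₙ^νₙ` of `ℤⁿ` given by a point of the torus. -/
def latticeChar {n : ℕ} (z : Fin n → Circle) : Multiplicative (Fin n → ℤ) →* Circle where
  toFun ν := ∏ i, z i ^ ν.toAdd i
  map_one' := by simp
  map_mul' μ ν := by simp [zpow_add, Finset.prod_mul_distrib]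

theorem latticeChar_apply {n : ℕ} (z : Fin n → Circle) (ν : Fin n → ℤ) :
    (latticeChar z (.ofAdd ν) : ℂ) = ∏ i, (z i : ℂ) ^ ν i := by
  change Circle.coeHom (∏ i, z i ^ ν i) = _
  rw [map_prod]
  exact Finset.prod_congr rfl fun i _ => Circle.coe_zpow _ _

theorem tsum_ofGroupRing {n : ℕ} (f : AddMonoidAlgebra ℂ (Fin n → ℤ)) (z : Fin n → Circle) :
    ∑' ν, ofGroupRing f ν * latticeChar z (.ofAdd ν) = laurentEval f z := by
  rw [tsum_eq_sum (s := f.coeff.support) (fun ν hν => by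
    rw [Finsupp.notMem_support_iff] at hν
    simp [ofGroupRing, hν])]
  simp only [latticeChar_apply]
  rfl

theorem laurentEval_ne_zero_of_isUnit {n : ℕ} {f : AddMonoidAlgebra ℂ (Fin n → ℤ)}
    (hf : IsUnit (ofGroupRing f)) (z : Fin n → Circle) : laurentEval f z ≠ 0 := by
  classical
  obtain ⟨g, hg⟩ := hf.exists_right_inv
  have h := tsum_mul_character (latticeChar z) (ofGroupRing f) g
  rw [hg, tsum_ofGroupRing, tsum_eq_single 0 (fun ν hν => by simp [one_apply, hν])] at h
  intro h0
  simp [h0, one_apply] at h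

open WeakDual in
/-- Every character of the Banach algebra `L¹(ℤⁿ)` is, on the group ring, evaluation at a point of
the torus: an element of `ℤⁿ` and its inverse both have norm `1` in `L¹(ℤⁿ)`, so the values of the
character at them have modulus at most `1`, hence equal to `1`. -/
theorem exists_laurentEval_eq_characterSpace {n : ℕ}
    (φ : characterSpace ℂ (ConvL1 (Fin n → ℤ))) :
    ∃ z : Fin n → Circle, ∀ f, φ (ofGroupRing f) = laurentEval f z := by
  let ψ : Multiplicative (Fin n → ℤ) →* ℂ :=
    { toFun := fun ν => φ (delta ν.toAdd)
      map_one' := by rw [toAdd_one, delta_zero, map_one]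
      map_mul' := fun μ ν => by rw [toAdd_mul, ← delta_mul, map_mul] }
  have hle (ν : Multiplicative (Fin n → ℤ)) : ‖ψ ν‖ ≤ 1 := by
    have h1 : ‖(1 : ConvL1 (Fin n → ℤ))‖ = 1 := by rw [← delta_zero, norm_delta]
    have : NormOneClass (ConvL1 (Fin n → ℤ)) := ⟨h1⟩
    have := spectrum.norm_le_norm_of_mem (AlgHom.apply_mem_spectrum φ (delta ν.toAdd))
    rwa [norm_delta] at this
  have hone (ν : Multiplicative (Fin n → ℤ)) : ‖ψ ν‖ = 1 := by
    refine le_antisymm (hle ν) ?_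
    have h : ‖ψ ν‖ * ‖ψ ν⁻¹‖ = 1 := by rw [← norm_mul, ← map_mul, mul_inv_cancel, map_one, norm_one]
    nlinarith [hle ν⁻¹, norm_nonneg (ψ ν)]
  refine ⟨fun i => ⟨ψ (.ofAdd (Pi.single i 1)), mem_sphere_zero_iff_norm.2 (hone _)⟩, fun f => ?_⟩
  rw [ofGroupRing_eq_sum, map_sum]
  refine Finset.sum_congr rfl fun ν _ => ?_
  rw [map_smul, smul_eq_mul]
  congr 1
  have hν : (.ofAdd ν : Multiplicative (Fin n → ℤ)) =
      ∏ i, (.ofAdd (Pi.single i 1 : Fin n → ℤ) : Multiplicative (Fin n → ℤ)) ^ ν i := by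
    rw [← Multiplicative.toAdd.injective.eq_iff, toAdd_prod]
    ext j
    simp [Pi.single_apply]
  change ψ (.ofAdd ν) = _
  rw [hν, map_prod]
  exact Finset.prod_congr rfl fun i _ => map_zpow' ψ (fun ν => eq_inv_of_mul_eq_one_left
    (by rw [← map_mul, inv_mul_cancel, map_one])) _ _

/-- Wiener's lemma for Laurent polynomials, by Gelfand theory. -/
theorem isUnit_of_laurentEval_ne_zero {n : ℕ} {f : AddMonoidAlgebra ℂ (Fin n → ℤ)}
    (hf : ∀ z : Fin n → Circle, laurentEval f z ≠ 0) : IsUnit (ofGroupRing f) := by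
  by_contra h
  obtain ⟨φ, hφ⟩ := WeakDual.CharacterSpace.exists_apply_eq_zero h
  obtain ⟨z, hz⟩ := exists_laurentEval_eq_characterSpace φ
  exact hf z ((hz f).symm.trans hφ)

end ConvL1

/-! ### Invertible elements of `C*`-algebras and von Neumann algebras -/

/-- Spectral permanence: an injective representation of a `C*`-algebra reflects invertibility. -/
theorem StarAlgHom.isUnit_of_isUnit_map {A B : Type*} [CStarAlgebra A] [CStarAlgebra B]
    (φ : A →⋆ₐ[ℂ] B) (hφ : Function.Injective φ) {a : A} (ha : IsUnit (φ a)) : IsUnit a := by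
  have hclosed : IsClosed (φ.range : Set B) := by
    exact (NonUnitalStarAlgHom.isometry φ hφ).isClosedEmbedding.isClosed_range
  obtain ⟨e, he⟩ : ∃ e : A ≃⋆ₐ[ℂ] φ.range, ∀ x, (e x : B) = φ x :=
    ⟨StarAlgEquiv.ofInjective φ hφ, fun _ => rfl⟩
  rw [← he a, StarSubalgebra.coe_isUnit] at ha
  exact (MulEquiv.isUnit_map e).1 ha

namespace groupVonNeumannAlgebra

variable {Γ : Type*} [AddGroup Γ]

/-- The inverse of an invertible operator commutes with whatever the operator commutes with, so
`𝒩Γ` is closed under inverses. -/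
theorem isUnit_iff {u : groupVonNeumannAlgebra Γ} :
    IsUnit u ↔ IsUnit (u : GroupL2 Γ →L[ℂ] GroupL2 Γ) := by
  refine ⟨fun h => ?_, fun h => ?_⟩
  · obtain ⟨v, hv, hv'⟩ := isUnit_iff_exists.1 h
    exact isUnit_iff_exists.2 ⟨v, congrArg Subtype.val hv, congrArg Subtype.val hv'⟩
  · obtain ⟨v, hv⟩ := h
    have hmem : (↑v⁻¹ : GroupL2 Γ →L[ℂ] GroupL2 Γ) ∈ groupVonNeumannAlgebra Γ := by
      refine mem_iff.2 fun γ => ?_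
      have hc : Commute (leftTranslation γ) (v : GroupL2 Γ →L[ℂ] GroupL2 Γ) := by
        rw [hv]; exact mem_iff.1 u.2 γ
      exact hc.units_inv_right
    refine isUnit_iff_exists.2 ⟨⟨_, hmem⟩, Subtype.ext ?_, Subtype.ext ?_⟩
    · change (u : GroupL2 Γ →L[ℂ] GroupL2 Γ) * ↑v⁻¹ = 1
      rw [← hv, v.mul_inv]
    · change ↑v⁻¹ * (u : GroupL2 Γ →L[ℂ] GroupL2 Γ) = 1
      rw [← hv, v.inv_mul]

end groupVonNeumannAlgebra

/-- A representation `φ` of `C(X)` sends `log |g|²` to `log (φ(g) φ(g)*)`: as `CFC.log` inverts the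
exponential on selfadjoint elements, it suffices that `exp (log |g|²) = g g*`, which holds
pointwise, and that `φ` commutes with the exponential series. -/
theorem StarAlgHom.log_mul_star_map {X B : Type*} [TopologicalSpace X] [CompactSpace X]
    [CStarAlgebra B] (φ : C(X, ℂ) →⋆ₐ[ℂ] B) {g h : C(X, ℂ)} (hg : ∀ x, g x ≠ 0)
    (hh : ∀ x, h x = ((2 * Real.log ‖g x‖ : ℝ) : ℂ)) :
    CFC.log (φ g * star (φ g)) = φ h := by
  have hball : h ∈ Metric.eball (0 : C(X, ℂ)) (NormedSpace.expSeries ℂ C(X, ℂ)).radius :=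
    (NormedSpace.expSeries_radius_eq_top ℂ C(X, ℂ)).symm ▸ edist_lt_top _ _
  have hexp : NormedSpace.exp h = g * star g := by
    ext x
    have hx := NormedSpace.map_exp_of_mem_ball (𝕂 := ℂ)
      (ContinuousMap.evalStarAlgHom ℂ ℂ x : C(X, ℂ) →⋆ₐ[ℂ] ℂ) (continuous_eval_const x) h hball
    change NormedSpace.exp h x = NormedSpace.exp (h x) at hx
    change _ = g x * star (g x)
    rw [hx, ← Complex.exp_eq_exp_ℂ, hh, ← Complex.ofReal_exp, two_mul, Real.exp_add,
      Real.exp_log (norm_pos_iff.2 (hg x)), RCLike.star_def, RCLike.mul_conj]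
    simp [sq]
  have hsa : IsSelfAdjoint h := by
    ext x
    change star (h x) = h x
    rw [hh, RCLike.star_def, Complex.conj_ofReal]
  have hφ := NormedSpace.map_exp_of_mem_ball (𝕂 := ℂ) φ
    (AddMonoidHomClass.continuous_of_bound φ 1 fun x => by
      simpa using NonUnitalStarAlgHom.norm_apply_le φ x) h hball
  rw [← map_star, ← map_mul, ← hexp, hφ, CFC.log_exp _ (hsa.map φ)]

/-! ### The Fourier transform of the group von Neumann algebra -/

section Fourier

variable {n : ℕ}

/-- Fourier transform `L²(Tⁿ) ≃ L²(ℤⁿ)`, sending `z^(-ν)` to the indicator function of `{ν}`. -/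
def fourierL2 (n : ℕ) : Lp ℂ 2 (torusHaar n) ≃ₗᵢ[ℂ] GroupL2 (Fin n → ℤ) :=
  (torusChar.hilbertBasis n).repr

theorem fourierL2_torusChar (ν : Fin n → ℤ) :
    fourierL2 n (ContinuousMap.toLp 2 (torusHaar n) ℂ (torusChar (-ν))) = delta ν := by
  classical
  rw [← torusChar.hilbertBasis_apply]
  refine ((torusChar.hilbertBasis n).repr_self ν).trans ?_
  unfold delta
  congr!

theorem fourierL2_symm_delta (ν : Fin n → ℤ) :
    (fourierL2 n).symm (delta ν) = ContinuousMap.toLp 2 (torusHaar n) ℂ (torusChar (-ν)) := by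
  rw [← fourierL2_torusChar, LinearIsometryEquiv.symm_apply_apply]

/-- The representation of `C(Tⁿ)` on `L²(ℤⁿ)`: multiplication operators, transported by the Fourier
transform. -/
def torusRep (n : ℕ) :
    C(Fin n → Circle, ℂ) →⋆ₐ[ℂ] (GroupL2 (Fin n → ℤ) →L[ℂ] GroupL2 (Fin n → ℤ)) :=
  ((fourierL2 n).conjStarAlgEquiv : _ →⋆ₐ[ℂ] _).comp (multiplicationHom (torusHaar n))

theorem torusRep_apply (g : C(Fin n → Circle, ℂ)) (x : GroupL2 (Fin n → ℤ)) :
    torusRep n g x = fourierL2 n (multiplicationHom (torusHaar n) g ((fourierL2 n).symm x)) :=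
  rfl

theorem torusRep_injective : Function.Injective (torusRep n) :=
  (fourierL2 n).conjStarAlgEquiv.injective.comp (multiplicationHom_injective (torusHaar n))

theorem rightTranslation_delta {Γ : Type*} [AddGroup Γ] (γ ν : Γ) :
    rightTranslation γ (delta ν) = delta (ν + γ) := by
  classical
  refine GroupL2.ext fun δ => ?_
  rw [rightTranslation_apply]
  simp only [delta, lp.coeFn_single, Pi.single_apply, ← sub_eq_add_neg, sub_eq_iff_eq_add]

theorem torusRep_torusChar (γ : Fin n → ℤ) :
    torusRep n (torusChar γ) = rightTranslation (-γ) := by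
  have hd : Dense (Submodule.span ℂ (Set.range (delta (Γ := Fin n → ℤ))) :
      Set (GroupL2 (Fin n → ℤ))) := by
    have h := (torusChar.hilbertBasis n).dense_span
    have h' := (fourierL2 n).surjective.denseRange.dense_image (fourierL2 n).continuous
      (Submodule.dense_iff_topologicalClosure_eq_top.2 h)
    refine h'.mono ?_
    rintro _ ⟨x, hx, rfl⟩
    have := Submodule.mem_map_of_mem (f := (fourierL2 n).toLinearEquiv.toLinearMap) hx
    rw [Submodule.map_span, ← Set.range_comp] at this
    refine Submodule.span_mono ?_ this
    rintro _ ⟨ν, rfl⟩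
    refine ⟨ν, ?_⟩
    rw [← fourierL2_torusChar, ← torusChar.hilbertBasis_apply]
    rfl
  refine ContinuousLinearMap.ext_on hd ?_
  rintro _ ⟨ν, rfl⟩
  rw [torusRep_apply, fourierL2_symm_delta, multiplicationHom_toLp, ← torusChar.add,
    rightTranslation_delta, ← fourierL2_torusChar, neg_add, neg_neg, add_comm]

/-- A Laurent polynomial as a continuous function on the torus. -/
def laurentMap (f : AddMonoidAlgebra ℂ (Fin n → ℤ)) : C(Fin n → Circle, ℂ) :=
  ∑ ν ∈ f.coeff.support, f.coeff ν • torusChar ν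

theorem laurentMap_apply (f : AddMonoidAlgebra ℂ (Fin n → ℤ)) (z : Fin n → Circle) :
    laurentMap f z = laurentEval f z := by
  rw [laurentMap, ContinuousMap.sum_apply]
  refine Finset.sum_congr rfl fun ν _ => ?_
  change f.coeff ν * Circle.coeHom (∏ i, z i ^ ν i) = _
  rw [map_prod]
  exact congrArg _ (Finset.prod_congr rfl fun i _ => Circle.coe_zpow _ _)

theorem isUnit_laurentMap_iff {f : AddMonoidAlgebra ℂ (Fin n → ℤ)} :
    IsUnit (laurentMap f) ↔ ∀ z, laurentEval f z ≠ 0 := by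
  simp only [ContinuousMap.isUnit_iff_forall_ne_zero, laurentMap_apply]

theorem torusRep_laurentMap (f : AddMonoidAlgebra ℂ (Fin n → ℤ)) :
    torusRep n (laurentMap f) = (groupVonNeumannAlgebra.ofGroupRing f).1 := by
  rw [laurentMap, map_sum]
  exact Finset.sum_congr rfl fun ν _ => by rw [map_smul, torusRep_torusChar]

/-- The von Neumann trace is integration over the torus. -/
theorem inner_delta_torusRep (g : C(Fin n → Circle, ℂ)) :
    inner ℂ (delta (0 : Fin n → ℤ)) (torusRep n g (delta 0)) = ∫ z, g z ∂(torusHaar n) := by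
  rw [torusRep_apply, fourierL2_symm_delta, ← fourierL2_torusChar,
    LinearIsometryEquiv.inner_map_map, multiplicationHom_toLp, ContinuousMap.inner_toLp, neg_zero,
    torusChar.zero]
  simp

theorem isUnit_ofGroupRing_iff {f : AddMonoidAlgebra ℂ (Fin n → ℤ)} :
    IsUnit (groupVonNeumannAlgebra.ofGroupRing f) ↔ ∀ z, laurentEval f z ≠ 0 := by
  rw [groupVonNeumannAlgebra.isUnit_iff, ← torusRep_laurentMap, ← isUnit_laurentMap_iff]
  exact ⟨(torusRep n).isUnit_of_isUnit_map torusRep_injective, fun h => h.map (torusRep n)⟩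

theorem continuous_log_norm_laurentEval {f : AddMonoidAlgebra ℂ (Fin n → ℤ)}
    (hf : ∀ z, laurentEval f z ≠ 0) : Continuous fun z => Real.log ‖laurentEval f z‖ := by
  refine Continuous.log ?_ fun z => norm_ne_zero_iff.2 (hf z)
  simp only [← laurentMap_apply]
  fun_prop

theorem trace_logMulStar_ofGroupRing {f : AddMonoidAlgebra ℂ (Fin n → ℤ)}
    (hf : ∀ z, laurentEval f z ≠ 0) :
    groupVonNeumannAlgebra.trace
        (groupVonNeumannAlgebra.logMulStar (groupVonNeumannAlgebra.ofGroupRing f)) =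
      ((2 * ∫ z, Real.log ‖laurentEval f z‖ ∂(torusHaar n) : ℝ) : ℂ) := by
  let h : C(Fin n → Circle, ℂ) :=
    ⟨fun z => ((2 * Real.log ‖laurentEval f z‖ : ℝ) : ℂ), by
      have := continuous_log_norm_laurentEval hf
      fun_prop⟩
  have hlog := (torusRep n).log_mul_star_map (g := laurentMap f) (h := h)
    (fun z => by rw [laurentMap_apply]; exact hf z) (fun z => by rw [laurentMap_apply]; rfl)
  rw [torusRep_laurentMap] at hlog
  refine (congrArg (fun A : GroupL2 (Fin n → ℤ) →L[ℂ] GroupL2 (Fin n → ℤ) =>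
    inner ℂ (delta (0 : Fin n → ℤ)) (A (delta 0))) hlog).trans ?_
  rw [inner_delta_torusRep, ← integral_const_mul, ← integral_complex_ofReal]
  rfl

theorem integrable_log_norm_laurentEval {f : AddMonoidAlgebra ℂ (Fin n → ℤ)}
    (hf : ∀ z, laurentEval f z ≠ 0) :
    Integrable (fun z => Real.log ‖laurentEval f z‖) (torusHaar n) := by
  exact (continuous_log_norm_laurentEval hf).integrable_of_hasCompactSupport (.of_compactSpace _)

end Fourier

end

theorem proposition4 (n : ℕ) (f : AddMonoidAlgebra ℂ (Fin n → ℤ)) :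
    List.TFAE
      [IsUnit (ConvL1.ofGroupRing f),
        IsUnit (groupVonNeumannAlgebra.ofGroupRing f),
        ∀ z : Fin n → Circle, laurentEval f z ≠ 0] ∧
    ∀ hf : IsUnit (groupVonNeumannAlgebra.ofGroupRing f),
      MeasureTheory.Integrable (fun z => Real.log ‖laurentEval f z‖) (torusHaar n) ∧
      groupVonNeumannAlgebra.det hf.unit =
        Real.exp (∫ z, Real.log ‖laurentEval f z‖ ∂(torusHaar n)) := by
  refine ⟨?_, fun hf => ?_⟩
  · tfae_have 1 → 3 := ConvL1.laurentEval_ne_zero_of_isUnit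
    tfae_have 3 → 1 := ConvL1.isUnit_of_laurentEval_ne_zero
    tfae_have 2 ↔ 3 := isUnit_ofGroupRing_iff
    tfae_finish
  · have h := isUnit_ofGroupRing_iff.1 hf
    refine ⟨integrable_log_norm_laurentEval h, ?_⟩
    rw [groupVonNeumannAlgebra.det, hf.unit_spec, trace_logMulStar_ofGroupRing h,
      Complex.ofReal_re, one_div, inv_mul_cancel_left₀ two_ne_zero]
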